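/- Let $m,n\ge 1$, let $U\subseteq\mathbb{R}^n$ be open, and let $F=\sqrt[m]{A}$ be an $m$-th root Finsler metric on $U$: that is, $F:U\times\mathbb{R}^n\to[0,\infty)$ satisfies $F^m=A$ with $A(x,y)=\sum a_{i_1\dots i_m}(x)\,y^{i_1}\cdots y^{i_m}$, where $a_{i_1\dots i_m}$ is symmetric in its indices; $F$ is $C^\infty$ on $U\times(\mathbb{R}^n\setminus\{0\})$; $F(x,\lambda y)=\lambda F(x,y)$ for $\lambda>0$; and the matrix $g_{ij}(x,y)=\tfrac12\,\partial^2F^2/\partial y^i\partial y^j$ is positive definite for all $x\in U$, $y\ne0$. With $(g^{ij})=(g_{ij})^{-1}$ (and summation over repeated indices), let $$G^i=\tfrac14 g^{il}\Big(\frac{\partial^2F^2}{\partial x^k\partial y^l}y^k-\frac{\partial F^2}{\partial x^l}\Big),\qquad B^i{}_{jkl}=\frac{\partial^3G^i}{\partial y^j\partial y^k\partial y^l}$$ be the spray coefficients and the Berwald curvature of $F$. Suppose that $F$ has isotropic Berwald curvature, i.e. there is a scalar function $c=c(x)$ on $U$ such that, for all $x\in U$, $y\neq 0$ and all indices, $$B^i{}_{jkl}=c\,\big\{F_{y^jy^k}\delta^i_l+F_{y^ky^l}\delta^i_j+F_{y^ly^j}\delta^i_k+F_{y^jy^ky^l}\,y^i\big\}.$$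 Then the S-curvature of $F$ vanishes: for all $x\in U$ and $y\ne0$, $$\mathbf{S}(x,y):=\frac{d}{dt}\Big|_{t=0}\tau(\sigma(t),\dot\sigma(t))=0,$$ where $\sigma$ is the geodesic ($\ddot\sigma^i+2G^i(\sigma,\dot\sigma)=0$) with $\sigma(0)=x$, $\dot\sigma(0)=y$, and $$\tau(x,y)=\ln\Big[\frac{\sqrt{\det(g_{ij}(x,y))}}{\mathrm{Vol}(\mathbb{B}^n(1))}\,\mathrm{Vol}\{z\in\mathbb{R}^n: F(x,z)<1\}\Big]$$ is the distortion, $\mathrm{Vol}$ being the Euclidean volume and $\mathbb{B}^n(1)$ the Euclidean unit ball. -/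

import Mathlib

open scoped ContDiff

namespace FinslerRoot

/-- The coordinate space `ℝⁿ`. -/
abbrev E (n : ℕ) : Type := EuclideanSpace ℝ (Fin n)

/-- The `i`-th partial derivative `∂f/∂zⁱ` of a scalar function on `ℝⁿ`. -/
noncomputable def pd {n : ℕ} (i : Fin n) (f : E n → ℝ) (z : E n) : ℝ :=
  fderiv ℝ f z (EuclideanSpace.single i 1)

/-- The fundamental tensor `g_ij(x,y) = ½ ∂²F²/∂yⁱ∂yʲ`. -/
noncomputable def fundTensor {n : ℕ} (F : E n → E n → ℝ) (x y : E n) :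
    Matrix (Fin n) (Fin n) ℝ :=
  Matrix.of fun i j => 1 / 2 * pd i (pd j fun z => F x z ^ 2) y

/-- `F` (first argument the base point, second argument the tangent vector) is a Finsler metric
on the open set `U ⊆ ℝⁿ`. Values at base points outside `U` are irrelevant. -/
structure IsFinslerMetric {n : ℕ} (U : Set (E n)) (F : E n → E n → ℝ) : Prop where
  nonneg : ∀ x ∈ U, ∀ y, 0 ≤ F x y
  smooth : ContDiffOn ℝ ∞ (fun p : E n × E n => F p.1 p.2) {p | p.1 ∈ U ∧ p.2 ≠ 0}
  homogeneous : ∀ x ∈ U, ∀ (y : E n) (r : ℝ), 0 < r → F x (r • y) = r * F x y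
  posDef : ∀ x ∈ U, ∀ y, y ≠ 0 → (fundTensor F x y).PosDef

/-- The (nonnegative) function `F` is the `m`-th root of a form
`A = a_{i₁…iₘ}(x) y^{i₁}⋯y^{iₘ}` whose coefficients are symmetric in all indices. -/
def IsRootMetric {n : ℕ} (m : ℕ) (U : Set (E n)) (F : E n → E n → ℝ) : Prop :=
  ∃ a : E n → (Fin m → Fin n) → ℝ,
    (∀ x ∈ U, ∀ (I : Fin m → Fin n) (π : Equiv.Perm (Fin m)), a x (I ∘ π) = a x I) ∧
    ∀ x ∈ U, ∀ y, F x y ^ m = ∑ I : Fin m → Fin n, a x I * ∏ k, y (I k)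

/-- The spray coefficients
`Gⁱ = ¼ gⁱˡ ((∂²F²/∂xᵏ∂yˡ) yᵏ - ∂F²/∂xˡ)`. -/
noncomputable def spray {n : ℕ} (F : E n → E n → ℝ) (x y : E n) (i : Fin n) : ℝ :=
  1 / 4 * ∑ l, (fundTensor F x y)⁻¹ i l *
    ((∑ k, pd k (fun x' => pd l (fun z => F x' z ^ 2) y) x * y k)
      - pd l (fun x' => F x' y ^ 2) x)

/-- The Berwald curvature `Bⁱ_jkl = ∂³Gⁱ/∂yʲ∂yᵏ∂yˡ`. -/
noncomputable def berwald {n : ℕ} (F : E n → E n → ℝ) (x y : E n) (i j k l : Fin n) : ℝ :=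
  pd j (pd k (pd l fun z => spray F x z i)) y

/-- `F` has isotropic Berwald curvature on `U`: for some scalar function `c = c(x)`,
`Bⁱ_jkl = c (F_{yʲyᵏ} δⁱ_l + F_{yᵏyˡ} δⁱ_j + F_{yˡyʲ} δⁱ_k + F_{yʲyᵏyˡ} yⁱ)`. -/
def HasIsotropicBerwaldCurvature {n : ℕ} (U : Set (E n)) (F : E n → E n → ℝ) : Prop :=
  ∃ c : E n → ℝ, ∀ x ∈ U, ∀ y, y ≠ 0 → ∀ i j k l : Fin n,
    berwald F x y i j k l =
      c x * (pd j (pd k (F x)) y * (if i = l then 1 else 0)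
        + pd k (pd l (F x)) y * (if i = j then 1 else 0)
        + pd l (pd j (F x)) y * (if i = k then 1 else 0)
        + pd j (pd k (pd l (F x))) y * y i)

/-- The distortion
`τ(x,y) = ln (√(det g_ij(x,y)) / Vol(Bⁿ(1)) · Vol {y ∈ ℝⁿ | F(x,y) < 1})`. -/
noncomputable def distortion {n : ℕ} (F : E n → E n → ℝ) (x y : E n) : ℝ :=
  Real.log (Real.sqrt (fundTensor F x y).det
    / MeasureTheory.volume.real (Metric.ball (0 : E n) 1)
    * MeasureTheory.volume.real {z : E n | F x z < 1})

/-- `σ`, restricted to `(-ε, ε)`, is a (nonconstant) geodesic in `U` with `σ(0) = x`,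
`σ̇(0) = y`: it solves `σ̈ⁱ + 2 Gⁱ(σ, σ̇) = 0`. -/
structure IsGeodesicFrom {n : ℕ} (U : Set (E n)) (F : E n → E n → ℝ) (x y : E n)
    (ε : ℝ) (σ : ℝ → E n) : Prop where
  pos : 0 < ε
  start : σ 0 = x
  velocity : deriv σ 0 = y
  mem : ∀ t ∈ Set.Ioo (-ε) ε, σ t ∈ U
  velocity_ne : ∀ t ∈ Set.Ioo (-ε) ε, deriv σ t ≠ 0
  differentiable : ∀ t ∈ Set.Ioo (-ε) ε, DifferentiableAt ℝ σ t
  geodesic_eq : ∀ t ∈ Set.Ioo (-ε) ε,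
    HasDerivAt (deriv σ) (WithLp.toLp 2 fun i => -2 * spray F (σ t) (deriv σ t) i) t

/-- The S-curvature of `F` at `(x,y)` exists and equals `s`: there is a geodesic `σ` with
`σ(0) = x`, `σ̇(0) = y`, and along each such geodesic the derivative at `t = 0` of
`τ(σ(t), σ̇(t))` exists and equals `s`. -/
def HasSCurvatureAt {n : ℕ} (U : Set (E n)) (F : E n → E n → ℝ) (x y : E n) (s : ℝ) : Prop :=
  (∃ ε σ, IsGeodesicFrom U F x y ε σ) ∧
    ∀ ε σ, IsGeodesicFrom U F x y ε σ →
      HasDerivAt (fun t => distortion F (σ t) (deriv σ t)) s 0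

end FinslerRoot

/-!
The metric is reversible: the form `A` satisfies `A(x,-y) = (-1)ᵐ A(x,y)` and `F ≥ 0`, so
`F(x,-y) = F(x,y)` for either parity of `m` (`IsRootMetric.map_neg`). Hence the spray coefficients
are even in `y` and the Berwald curvature is odd, whereas the tensor multiplying `c(x)` in the
isotropy condition is even. Both sides of the condition therefore vanish
(`HasIsotropicBerwaldCurvature.berwald_eq_zero`), and `F` is a Berwald metric.

For a Berwald metric `∂²Gⁱ/∂yᵏ∂yˡ` depends on `x` only (`christoffel_eq`), so the spray comes from a
linear connection on `U` (`fderiv_sprayVec`, `connection_self`). Since `F` is constant along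
horizontal directions, `∂F²/∂xᵏ = (∂Gⁱ/∂yᵏ) ∂F²/∂yⁱ` (`fderiv_energy_horizontal`), parallel transport
`P` along a curve consists of linear isometries between the Minkowski norms `F(σ(0), ·)` and
`F(σ(t), ·)` (`energy_transport`), and along a geodesic it maps the initial velocity to the velocity.
A linear isometry `P` multiplies the volume of the unit ball by `|det P|` and divides `√(det g)` by
the same factor (`distortion_comp_clm`), so the distortion is constant along geodesics.

The geodesic and the transport along it are obtained together: the autonomous system
`σ̇ = P y`, `Ṗ = -Γ(σ)(P y) P` with `P(0) = id` has a solution (`exists_transport`), and its first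
component is the geodesic with initial velocity `y`, the unique one near `t = 0`
(`IsGeodesicFrom.eventuallyEq`).
-/

namespace FinslerRoot

open Filter Topology

variable {n : ℕ} {U : Set (E n)} {F : E n → E n → ℝ} {x x' y e : E n}

/-! ### Reversibility and the vanishing of the Berwald curvature -/

lemma pd_const_mul (i : Fin n) (c : ℝ) (f : E n → ℝ) (y : E n) :
    pd i (fun z => c * f z) y = c * pd i f y := by
  have : (fun z => c * f z) = c • f := rfl
  rw [pd, this, fderiv_const_smul_field]
  rfl

lemma pd_smul_of_scaling {f : E n → ℝ} {r c : ℝ} (hr : r ≠ 0)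
    (hf : ∀ z, f (r • z) = c * f z) (i : Fin n) (z : E n) :
    pd i f (r • z) = c / r * pd i f z := by
  have h : pd i (fun z => f (r • z)) z = r * pd i f (r • z) := by
    simp [pd, fderiv_comp_smul]
  rw [funext hf, pd_const_mul] at h
  field_simp
  linarith

lemma pd_congr {f g : E n → ℝ} (h : f =ᶠ[𝓝 x] g) (i : Fin n) : pd i f x = pd i g x := by
  rw [pd, h.fderiv_eq, pd]

/-- A nonnegative `m`-th root of a form of degree `m` is an even function of `y`, whatever the
parity of `m`: for odd `m` it vanishes identically. -/
lemma IsRootMetric.map_neg {m : ℕ} (hm : 1 ≤ m) (hroot : IsRootMetric m U F)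
    (hF : ∀ x ∈ U, ∀ y, 0 ≤ F x y) (hx : x ∈ U) (y : E n) : F x (-y) = F x y := by
  obtain ⟨a, -, ha⟩ := hroot
  have hneg : F x (-y) ^ m = (-1) ^ m * F x y ^ m := by
    rw [ha x hx, ha x hx, Finset.mul_sum]
    refine Finset.sum_congr rfl fun I _ => ?_
    have : ∏ k, (-y) (I k) = (-1) ^ m * ∏ k, y (I k) := by
      simp [Finset.prod_neg]
    rw [this]
    ring
  have h0 := hF x hx y
  have h1 := hF x hx (-y)
  rcases Nat.even_or_odd m with he | ho
  · rw [he.neg_one_pow, one_mul] at hneg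
    exact (pow_left_inj₀ h1 h0 (by omega)).1 hneg
  · rw [ho.neg_one_pow, neg_one_mul] at hneg
    have h2 : F x y ^ m = 0 :=
      le_antisymm (by linarith [pow_nonneg h1 m]) (pow_nonneg h0 m)
    rw [h2, neg_zero] at hneg
    rw [eq_zero_of_pow_eq_zero h2, eq_zero_of_pow_eq_zero hneg]

lemma sq_smul_of_even (hF : IsFinslerMetric U F) (hev : ∀ x ∈ U, ∀ y, F x (-y) = F x y)
    (hx : x ∈ U) {r : ℝ} (hr : r ≠ 0) (y : E n) : F x (r • y) ^ 2 = r ^ 2 * F x y ^ 2 := by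
  rcases hr.lt_or_gt with h | h
  · have : r • y = -((-r) • y) := by simp
    rw [this, hev x hx, hF.homogeneous x hx y (-r) (by linarith)]
    ring
  · rw [hF.homogeneous x hx y r h]
    ring

lemma fundTensor_smul (hL : ∀ x ∈ U, ∀ r : ℝ, r ≠ 0 → ∀ y, F x (r • y) ^ 2 = r ^ 2 * F x y ^ 2)
    (hx : x ∈ U) {r : ℝ} (hr : r ≠ 0) (y : E n) :
    fundTensor F x (r • y) = fundTensor F x y := by
  ext i j
  have h1 := pd_smul_of_scaling (f := fun z => F x z ^ 2) hr (hL x hx r hr) j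
  have h2 := pd_smul_of_scaling hr h1 i y
  simp only [fundTensor, Matrix.of_apply, h2]
  field_simp

/-- The spray coefficients of a reversible metric scale by `r ^ 2` for all `r ≠ 0`, including
negative `r`. -/
lemma spray_smul (hU : IsOpen U)
    (hL : ∀ x ∈ U, ∀ r : ℝ, r ≠ 0 → ∀ y, F x (r • y) ^ 2 = r ^ 2 * F x y ^ 2)
    (hx : x ∈ U) {r : ℝ} (hr : r ≠ 0) (y : E n) (i : Fin n) :
    spray F x (r • y) i = r ^ 2 * spray F x y i := by
  have hUx : ∀ᶠ x' in 𝓝 x, x' ∈ U := hU.mem_nhds hx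
  have h1 : ∀ l k, pd k (fun x' => pd l (fun z => F x' z ^ 2) (r • y)) x
      = r * pd k (fun x' => pd l (fun z => F x' z ^ 2) y) x := by
    intro l k
    rw [← pd_const_mul]
    refine pd_congr (hUx.mono fun x' hx' => ?_) k
    have := pd_smul_of_scaling (f := fun z => F x' z ^ 2) hr (hL x' hx' r hr) l y
    simp only [this]
    field_simp
  have h2 : ∀ l, pd l (fun x' => F x' (r • y) ^ 2) x
      = r ^ 2 * pd l (fun x' => F x' y ^ 2) x := by
    intro l
    rw [← pd_const_mul]
    exact pd_congr (hUx.mono fun x' hx' => hL x' hx' r hr y) l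
  simp only [spray, fundTensor_smul hL hx hr, h1, h2, PiLp.smul_apply, smul_eq_mul,
    Finset.mul_sum]
  refine Finset.sum_congr rfl fun l _ => ?_
  rw [show ∑ k, r * pd k (fun x' => pd l (fun z => F x' z ^ 2) y) x * (r * y k)
      = r ^ 2 * ∑ k, pd k (fun x' => pd l (fun z => F x' z ^ 2) y) x * y k by
    rw [Finset.mul_sum]; exact Finset.sum_congr rfl fun k _ => by ring]
  ring

/-- For a reversible metric the Berwald curvature is odd in `y`, while the tensor on the right-hand
side of the isotropy condition is even; so both vanish. -/
lemma HasIsotropicBerwaldCurvature.berwald_eq_zero (hU : IsOpen U)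
    (hB : HasIsotropicBerwaldCurvature U F) (hF : IsFinslerMetric U F)
    (hev : ∀ x ∈ U, ∀ y, F x (-y) = F x y) (hx : x ∈ U) (hy : y ≠ 0) (i j k l : Fin n) :
    berwald F x y i j k l = 0 := by
  obtain ⟨c, hc⟩ := hB
  have hL : ∀ x ∈ U, ∀ r : ℝ, r ≠ 0 → ∀ y, F x (r • y) ^ 2 = r ^ 2 * F x y ^ 2 :=
    fun x hx r hr y => sq_smul_of_even hF hev hx hr y
  have h1 : (-1 : ℝ) ≠ 0 := by norm_num
  have g0 := fun z => spray_smul hU hL hx h1 z i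
  have g3 := pd_smul_of_scaling h1 (pd_smul_of_scaling h1
    (pd_smul_of_scaling (f := fun z => spray F x z i) h1 g0 l) k) j y
  have f0 : ∀ z, F x ((-1 : ℝ) • z) = 1 * F x z := fun z => by simp [hev x hx]
  have f1 := fun l => pd_smul_of_scaling h1 f0 l
  have f2 := fun k l => pd_smul_of_scaling h1 (f1 l) k
  have f3 := fun j k l => pd_smul_of_scaling h1 (f2 k l) j
  have e1 := hc x hx y hy i j k l
  have e2 := hc x hx ((-1 : ℝ) • y) (smul_ne_zero h1 hy) i j k l
  rw [f2, f2, f2, f3] at e2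
  have e3 : berwald F x ((-1 : ℝ) • y) i j k l = -berwald F x y i j k l := by
    rw [berwald, g3, berwald]
    norm_num
  rw [e3] at e2
  simp only [PiLp.smul_apply, smul_eq_mul] at e2
  ring_nf at e1 e2
  linarith

/-! ### The energy, its Euler relations and the spray -/

/-- The tangent bundle of `U` with its zero section removed. -/
def slitBundle (U : Set (E n)) : Set (E n × E n) := {p | p.1 ∈ U ∧ p.2 ≠ 0}

/-- The function `F²` on the tangent bundle. -/
def energy (F : E n → E n → ℝ) (p : E n × E n) : ℝ := F p.1 p.2 ^ 2

/-- The spray coefficients `Gⁱ`, collected into a vector-valued function on the tangent bundle. -/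
noncomputable def sprayVec (F : E n → E n → ℝ) (p : E n × E n) : E n :=
  WithLp.toLp 2 fun i => spray F p.1 p.2 i

lemma isOpen_slitBundle (hU : IsOpen U) : IsOpen (slitBundle U) :=
  (hU.preimage continuous_fst).inter (isOpen_ne.preimage continuous_snd)

lemma IsFinslerMetric.contDiffOn_energy (hF : IsFinslerMetric U F) :
    ContDiffOn ℝ ∞ (energy F) (slitBundle U) :=
  hF.smooth.pow 2

section Calculus

variable {V : Type*} [NormedAddCommGroup V] [NormedSpace ℝ V]

lemma clm_eq_sum (φ : E n →L[ℝ] V) (u : E n) :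
    φ u = ∑ i, u i • φ (EuclideanSpace.single i 1) := by
  conv_lhs => rw [← (EuclideanSpace.basisFun (Fin n) ℝ).sum_repr u]
  simp

lemma clm_eq_zero {φ : E n →L[ℝ] V} (h : ∀ i, φ (EuclideanSpace.single i 1) = 0) (u : E n) :
    φ u = 0 := by
  rw [clm_eq_sum]
  simp [h]

lemma fderiv_slice_snd {f : E n × E n → V} (hf : DifferentiableAt ℝ f (x, y)) (w : E n) :
    fderiv ℝ (fun z => f (x, z)) y w = fderiv ℝ f (x, y) (0, w) := by
  have h := hf.hasFDerivAt.comp y (hasFDerivAt_prodMk_right x y)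
  have h' : fderiv ℝ (fun z => f (x, z)) y = _ := h.fderiv
  rw [h']
  simp

lemma fderiv_slice_fst {f : E n × E n → V} (hf : DifferentiableAt ℝ f (x, y)) (w : E n) :
    fderiv ℝ (fun z => f (z, y)) x w = fderiv ℝ f (x, y) (w, 0) := by
  have h := HasFDerivAt.comp (g := f) (f := fun z => (z, y)) x hf.hasFDerivAt
    (hasFDerivAt_prodMk_left x y)
  have h' : fderiv ℝ (fun z => f (z, y)) x = _ := h.fderiv
  rw [h']
  simp

variable {f : E n × E n → V} {p : E n × E n}

lemma differentiableAt_of_slit (hU : IsOpen U) (hf : ContDiffOn ℝ ∞ f (slitBundle U))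
    (hp : p ∈ slitBundle U) : DifferentiableAt ℝ f p :=
  (hf.contDiffAt ((isOpen_slitBundle hU).mem_nhds hp)).differentiableAt (by simp)

lemma contDiffOn_fderiv (hU : IsOpen U) (hf : ContDiffOn ℝ ∞ f (slitBundle U)) :
    ContDiffOn ℝ ∞ (fderiv ℝ f) (slitBundle U) :=
  hf.fderiv_of_isOpen (isOpen_slitBundle hU) (by simp)

lemma contDiffOn_fderiv_apply (hU : IsOpen U) (hf : ContDiffOn ℝ ∞ f (slitBundle U))
    (v : E n × E n) : ContDiffOn ℝ ∞ (fun p => fderiv ℝ f p v) (slitBundle U) :=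
  (contDiffOn_fderiv hU hf).clm_apply contDiffOn_const

lemma fderiv_fderiv_apply (hU : IsOpen U) (hf : ContDiffOn ℝ ∞ f (slitBundle U))
    (hp : p ∈ slitBundle U) (v w : E n × E n) :
    fderiv ℝ (fun p => fderiv ℝ f p v) p w = fderiv ℝ (fderiv ℝ f) p w v := by
  have h := (differentiableAt_of_slit hU (contDiffOn_fderiv hU hf) hp).hasFDerivAt.clm_apply
    (hasFDerivAt_const v p)
  rw [h.fderiv]
  simp

lemma fderiv_fderiv_comm (hU : IsOpen U) (hf : ContDiffOn ℝ ∞ f (slitBundle U))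
    (hp : p ∈ slitBundle U) (v w : E n × E n) :
    fderiv ℝ (fderiv ℝ f) p v w = fderiv ℝ (fderiv ℝ f) p w v :=
  (hf.contDiffAt ((isOpen_slitBundle hU).mem_nhds hp)).isSymmSndFDerivAt
    (by simpa using WithTop.coe_le_coe.2 (le_top : (2 : ℕ∞) ≤ ⊤)) v w

lemma eventually_mem_slit_snd (hU : IsOpen U) (hp : (x, y) ∈ slitBundle U) :
    ∀ᶠ z in 𝓝 y, (x, z) ∈ slitBundle U :=
  (by fun_prop : Continuous fun z => (x, z)).continuousAt ((isOpen_slitBundle hU).mem_nhds hp)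

lemma eventually_mem_slit_fst (hU : IsOpen U) (hp : (x, y) ∈ slitBundle U) :
    ∀ᶠ z in 𝓝 x, (z, y) ∈ slitBundle U :=
  (by fun_prop : Continuous fun z => (z, y)).continuousAt ((isOpen_slitBundle hU).mem_nhds hp)

lemma pd_pd_slice {f : E n × E n → ℝ} (hU : IsOpen U) (hf : ContDiffOn ℝ ∞ f (slitBundle U))
    (hp : (x, y) ∈ slitBundle U) (i j : Fin n) :
    pd i (pd j fun z => f (x, z)) y = fderiv ℝ (fderiv ℝ f) (x, y)
      (0, EuclideanSpace.single i 1) (0, EuclideanSpace.single j 1) := by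
  rw [← fderiv_fderiv_apply hU hf hp,
    ← fderiv_slice_snd (differentiableAt_of_slit hU (contDiffOn_fderiv_apply hU hf _) hp)]
  exact pd_congr ((eventually_mem_slit_snd hU hp).mono fun z hz =>
    fderiv_slice_snd (differentiableAt_of_slit hU hf hz) _) i

/-- Euler's relation for functions that are homogeneous of degree `d` in `y`. -/
lemma fderiv_self_of_homogeneous {f : E n → V} (hf : DifferentiableAt ℝ f y) (d : ℕ)
    (h : ∀ r : ℝ, 0 < r → f (r • y) = r ^ d • f y) : fderiv ℝ f y y = (d : ℝ) • f y := by
  have h1 : HasDerivAt (fun r : ℝ => f (r • y)) (fderiv ℝ f y y) 1 := by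
    have hs : HasDerivAt (fun r : ℝ => r • y) y 1 := by
      simpa using (hasDerivAt_id (1 : ℝ)).smul_const y
    have hf' : HasFDerivAt f (fderiv ℝ f y) ((1 : ℝ) • y) := by
      rw [one_smul]; exact hf.hasFDerivAt
    exact hf'.comp_hasDerivAt 1 hs
  have h2 : HasDerivAt (fun r : ℝ => r ^ d • f y) ((d : ℝ) • f y) 1 := by
    simpa using (hasDerivAt_pow d (1 : ℝ)).smul_const (f y)
  refine h1.unique (h2.congr_of_eventuallyEq ?_)
  filter_upwards [lt_mem_nhds one_pos] with r hr using h r hr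

end Calculus

variable {p : E n × E n}

lemma pd_energy (hU : IsOpen U) (hF : IsFinslerMetric U F) (hp : (x, y) ∈ slitBundle U)
    (l : Fin n) : pd l (fun z => F x z ^ 2) y
      = fderiv ℝ (energy F) (x, y) (0, EuclideanSpace.single l 1) :=
  fderiv_slice_snd (f := energy F) (differentiableAt_of_slit hU hF.contDiffOn_energy hp) _

lemma fundTensor_apply (hU : IsOpen U) (hF : IsFinslerMetric U F) (hp : (x, y) ∈ slitBundle U)
    (i j : Fin n) : fundTensor F x y i j = 1 / 2 * fderiv ℝ (fderiv ℝ (energy F)) (x, y)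
      (0, EuclideanSpace.single i 1) (0, EuclideanSpace.single j 1) := by
  rw [← pd_pd_slice hU hF.contDiffOn_energy hp]
  rfl

lemma pd_pd_energy (hU : IsOpen U) (hF : IsFinslerMetric U F) (hp : (x, y) ∈ slitBundle U)
    (k l : Fin n) : pd k (fun x' => pd l (fun z => F x' z ^ 2) y) x
      = fderiv ℝ (fderiv ℝ (energy F)) (x, y)
        (EuclideanSpace.single k 1, 0) (0, EuclideanSpace.single l 1) := by
  have hL := hF.contDiffOn_energy
  rw [← fderiv_fderiv_apply hU hL hp,
    ← fderiv_slice_fst (differentiableAt_of_slit hU (contDiffOn_fderiv_apply hU hL _) hp)]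
  exact pd_congr ((eventually_mem_slit_fst hU hp).mono fun z hz => pd_energy hU hF hz l) k

/-- The lowered spray coefficients `F²_{xᵏyˡ} yᵏ - F²_{xˡ}`. -/
noncomputable def sprayCovector (F : E n → E n → ℝ) (p : E n × E n) (l : Fin n) : ℝ :=
  fderiv ℝ (fderiv ℝ (energy F)) p (p.2, 0) (0, EuclideanSpace.single l 1)
    - fderiv ℝ (energy F) p (EuclideanSpace.single l 1, 0)

lemma spray_eq_mulVec (hU : IsOpen U) (hF : IsFinslerMetric U F) (hp : (x, y) ∈ slitBundle U)
    (i : Fin n) : spray F x y i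
      = 1 / 4 * ((fundTensor F x y)⁻¹.mulVec (sprayCovector F (x, y))) i := by
  rw [spray, Matrix.mulVec, dotProduct]
  congr 1
  refine Finset.sum_congr rfl fun l _ => ?_
  congr 1
  rw [sprayCovector]
  congr 1
  · have h := clm_eq_sum (((fderiv ℝ (fderiv ℝ (energy F)) (x, y)).flip
      (0, EuclideanSpace.single l 1)).comp (ContinuousLinearMap.inl ℝ (E n) (E n))) y
    simp only [ContinuousLinearMap.comp_apply, ContinuousLinearMap.inl_apply,
      ContinuousLinearMap.flip_apply, smul_eq_mul] at h
    rw [h]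
    exact Finset.sum_congr rfl fun k _ => by rw [pd_pd_energy hU hF hp, mul_comm]
  · exact fderiv_slice_fst (f := energy F)
      (differentiableAt_of_slit hU hF.contDiffOn_energy hp) _

lemma contDiffOn_det {V : Type*} [NormedAddCommGroup V] [NormedSpace ℝ V] {s : Set V}
    {A : V → Matrix (Fin n) (Fin n) ℝ} (hA : ∀ i j, ContDiffOn ℝ ∞ (fun p => A p i j) s) :
    ContDiffOn ℝ ∞ (fun p => (A p).det) s := by
  simp only [Matrix.det_apply]
  exact ContDiffOn.sum fun σ _ => (contDiffOn_prod fun i _ => hA _ _).const_smul _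

lemma contDiffOn_sprayVec (hU : IsOpen U) (hF : IsFinslerMetric U F) :
    ContDiffOn ℝ ∞ (sprayVec F) (slitBundle U) := by
  have hL := hF.contDiffOn_energy
  rw [contDiffOn_euclidean]
  intro i
  have hg : ∀ i j, ContDiffOn ℝ ∞ (fun p : E n × E n => fundTensor F p.1 p.2 i j)
      (slitBundle U) := fun i j =>
    (contDiffOn_const.mul ((contDiffOn_fderiv_apply hU (contDiffOn_fderiv hU hL) _).clm_apply
      contDiffOn_const)).congr fun p hp => fundTensor_apply hU hF hp i j
  have hinv : ∀ i j, ContDiffOn ℝ ∞ (fun p : E n × E n => (fundTensor F p.1 p.2)⁻¹ i j)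
      (slitBundle U) := by
    intro i j
    simp only [Matrix.inv_def, Matrix.smul_apply, Ring.inverse_eq_inv', smul_eq_mul,
      Matrix.adjugate_apply]
    refine ((contDiffOn_det hg).inv fun p hp => (hF.posDef _ hp.1 _ hp.2).det_pos.ne').mul
      (contDiffOn_det fun a b => ?_)
    by_cases h : a = j
    · subst h
      simpa using contDiffOn_const
    · simpa [Matrix.updateRow_ne h] using hg a b
  have hb : ∀ l, ContDiffOn ℝ ∞ (fun p => sprayCovector F p l) (slitBundle U) := fun l =>
    (((contDiffOn_fderiv hU (contDiffOn_fderiv hU hL)).clm_apply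
      (contDiff_snd.prodMk contDiff_const).contDiffOn).clm_apply contDiffOn_const).sub
      (contDiffOn_fderiv_apply hU hL _)
  refine ContDiffOn.congr (f := fun p : E n × E n => 1 / 4 * ∑ l,
    (fundTensor F p.1 p.2)⁻¹ i l * sprayCovector F p l) ?_ fun p hp => spray_eq_mulVec hU hF hp i
  exact contDiffOn_const.mul (ContDiffOn.sum fun l _ => (hinv i l).mul (hb l))

/-- The defining equation of the spray, `4 g_il Gⁱ = F²_{xᵏyˡ} yᵏ - F²_{xˡ}`. -/
lemma hessian_sprayVec (hU : IsOpen U) (hF : IsFinslerMetric U F) (hp : p ∈ slitBundle U)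
    (w : E n) :
    2 * fderiv ℝ (fderiv ℝ (energy F)) p (0, w) (0, sprayVec F p)
      = fderiv ℝ (fderiv ℝ (energy F)) p (p.2, 0) (0, w) - fderiv ℝ (energy F) p (w, 0) := by
  obtain ⟨x, y⟩ := p
  set H := fderiv ℝ (fderiv ℝ (energy F)) (x, y) with hH
  have key := clm_eq_zero (φ := (2 : ℝ) • ((H.flip (0, sprayVec F (x, y))).comp
      (ContinuousLinearMap.inr ℝ (E n) (E n))) -
    ((H (y, 0)).comp (ContinuousLinearMap.inr ℝ (E n) (E n)) -
      (fderiv ℝ (energy F) (x, y)).comp (ContinuousLinearMap.inl ℝ (E n) (E n)))) ?_ w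
  · simpa [sub_eq_zero] using key
  intro l
  have h1 := clm_eq_sum ((H (0, EuclideanSpace.single l 1)).comp
    (ContinuousLinearMap.inr ℝ (E n) (E n))) (sprayVec F (x, y))
  have h2 : (fundTensor F x y).mulVec ((fundTensor F x y)⁻¹.mulVec (sprayCovector F (x, y))) l
      = sprayCovector F (x, y) l := by
    rw [Matrix.mulVec_mulVec, Matrix.mul_nonsing_inv _
      (hF.posDef _ hp.1 _ hp.2).det_pos.ne'.isUnit, Matrix.one_mulVec]
  have h3 : ∀ i, ((fundTensor F x y)⁻¹.mulVec (sprayCovector F (x, y))) i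
      = 4 * sprayVec F (x, y) i := by
    intro i
    change _ = 4 * spray F x y i
    rw [spray_eq_mulVec hU hF hp]
    ring
  rw [Matrix.mulVec, dotProduct] at h2
  simp only [h3, fundTensor_apply hU hF hp, ← hH] at h2
  simp only [ContinuousLinearMap.comp_apply, ContinuousLinearMap.inr_apply, smul_eq_mul] at h1
  simp only [sub_apply, smul_apply,
    ContinuousLinearMap.comp_apply, ContinuousLinearMap.inr_apply, ContinuousLinearMap.inl_apply,
    ContinuousLinearMap.flip_apply, smul_eq_mul, sub_eq_zero, h1]
  refine Eq.trans ?_ h2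
  rw [Finset.mul_sum]
  exact Finset.sum_congr rfl fun i _ => by ring

lemma fderiv_energy_self (hU : IsOpen U) (hF : IsFinslerMetric U F) (hp : p ∈ slitBundle U) :
    fderiv ℝ (energy F) p (0, p.2) = 2 * energy F p := by
  obtain ⟨x, y⟩ := p
  have hd := differentiableAt_of_slit hU hF.contDiffOn_energy hp
  have hd' : DifferentiableAt ℝ (fun z => energy F (x, z)) y :=
    hd.comp y (hasFDerivAt_prodMk_right x y).differentiableAt
  have h := fderiv_self_of_homogeneous hd' 2 fun r hr => by
    simp only [energy, hF.homogeneous x hp.1 y r hr, smul_eq_mul]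
    ring
  rw [fderiv_slice_snd hd] at h
  simpa using h

/-- Euler's relation for the derivative of `F²`. -/
lemma hessian_energy_self (hU : IsOpen U) (hF : IsFinslerMetric U F) (hp : p ∈ slitBundle U)
    (v : E n × E n) : fderiv ℝ (fderiv ℝ (energy F)) p v (0, p.2)
      = 2 * fderiv ℝ (energy F) p v - fderiv ℝ (energy F) p (0, v.2) := by
  have hL := hF.contDiffOn_energy
  have hW := isOpen_slitBundle hU
  have h1 := (differentiableAt_of_slit hU (contDiffOn_fderiv hU hL) hp).hasFDerivAt.clm_apply
    ((ContinuousLinearMap.inr ℝ (E n) (E n)).comp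
      (ContinuousLinearMap.snd ℝ (E n) (E n))).hasFDerivAt
  have h2 := (differentiableAt_of_slit hU hL hp).hasFDerivAt.const_mul 2
  have h3 := h1.unique (h2.congr_of_eventuallyEq
    (by filter_upwards [hW.mem_nhds hp] with q hq using fderiv_energy_self hU hF hq))
  have h4 := DFunLike.congr_fun h3 v
  simp at h4
  linarith

/-- The contraction of the spray equation with `y`. -/
lemma fderiv_energy_sprayVec (hU : IsOpen U) (hF : IsFinslerMetric U F)
    (hp : p ∈ slitBundle U) :
    2 * fderiv ℝ (energy F) p (0, sprayVec F p) = fderiv ℝ (energy F) p (p.2, 0) := by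
  have h1 := hessian_sprayVec hU hF hp p.2
  rw [fderiv_fderiv_comm hU hF.contDiffOn_energy hp, hessian_energy_self hU hF hp,
    hessian_energy_self hU hF hp] at h1
  have h0 : fderiv ℝ (energy F) p (0, 0) = 0 := map_zero _
  simp only [h0] at h1
  linarith

/-- `F` is constant along horizontal directions: `∂F²/∂xᵏ = (∂Gⁱ/∂yᵏ) ∂F²/∂yⁱ`. This follows by
differentiating the contracted spray equation in `y` and subtracting the spray equation. -/
lemma fderiv_energy_horizontal (hU : IsOpen U) (hF : IsFinslerMetric U F)
    (hp : p ∈ slitBundle U) (w : E n) :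
    fderiv ℝ (energy F) p (0, fderiv ℝ (sprayVec F) p (0, w))
      = fderiv ℝ (energy F) p (w, 0) := by
  have hL := hF.contDiffOn_energy
  have hW := isOpen_slitBundle hU
  have hD := (differentiableAt_of_slit hU (contDiffOn_fderiv hU hL) hp).hasFDerivAt
  have hG := (differentiableAt_of_slit hU (contDiffOn_sprayVec hU hF) hp).hasFDerivAt
  have h1 := (hD.clm_apply
    ((ContinuousLinearMap.inr ℝ (E n) (E n)).hasFDerivAt.comp p hG)).const_mul 2
  have h2 := hD.clm_apply ((ContinuousLinearMap.inl ℝ (E n) (E n)).comp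
      (ContinuousLinearMap.snd ℝ (E n) (E n))).hasFDerivAt
  have h3 := h1.unique (h2.congr_of_eventuallyEq
    (by filter_upwards [hW.mem_nhds hp] with q hq using fderiv_energy_sprayVec hU hF hq))
  have h4 := DFunLike.congr_fun h3 (0, w)
  have h5 := hessian_sprayVec hU hF hp w
  have h6 := fderiv_fderiv_comm hU hL hp (0, w) (p.2, 0)
  simp at h4
  linarith

/-! ### The linear connection of a reversible Berwald metric -/

lemma zero_notMem_segment_or (hy : y ≠ 0) (he : e ≠ 0) :
    (0 : E n) ∉ segment ℝ y e ∨ (0 : E n) ∉ segment ℝ (-y) e := by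
  by_contra! h
  obtain ⟨⟨a, b, ha, hb, hab, h1⟩, ⟨a', b', ha', hb', hab', h2⟩⟩ := h
  -- Eliminate `y` from `a y + b e = 0` and `-a' y + b' e = 0`.
  have h3 : (a * b' + b * a') • e = 0 := by
    have : (a * b' + b * a') • e = a' • (a • y + b • e) + a • (a' • -y + b' • e) := by
      module
    rw [this, h1, h2]
    simp
  have h4 := (smul_eq_zero.1 h3).resolve_right he
  have h5 : a * b' = 0 := by nlinarith [mul_nonneg ha hb', mul_nonneg hb ha']
  have h6 : b * a' = 0 := by linarith
  rcases mul_eq_zero.1 h5 with h | h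
  · have hb1 : b = 1 := by linarith
    simp [h, hb1, he] at h1
  · have ha1 : a' = 1 := by linarith
    have hb0 : b = 0 := by simpa [ha1] using h6
    have ha2 : a = 1 := by linarith
    simp [hb0, ha2, hy] at h1

/-- Evenness replaces the connectedness of the punctured space, which fails for `n = 1`: one of
the segments from `y` and `-y` to `e` avoids the origin. -/
lemma eq_of_even_of_fderiv_eq_zero {h : E n → ℝ} (hd : ∀ z ≠ 0, DifferentiableAt ℝ h z)
    (h0 : ∀ z ≠ 0, fderiv ℝ h z = 0) (hev : ∀ z, h (-z) = h z) (hy : y ≠ 0) (he : e ≠ 0) :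
    h y = h e := by
  have key : ∀ u, (0 : E n) ∉ segment ℝ u e → h u = h e := by
    intro u hu
    have hne : ∀ z ∈ segment ℝ u e, z ≠ 0 := fun z hz hz0 => hu (hz0 ▸ hz)
    have := (convex_segment u e).norm_image_sub_le_of_norm_hasFDerivWithin_le (C := 0)
      (fun z hz => (hd z (hne z hz)).hasFDerivAt.hasFDerivWithinAt)
      (fun z hz => by simp [h0 z (hne z hz)])
      (right_mem_segment ℝ u e) (left_mem_segment ℝ u e)
    rw [zero_mul, norm_le_zero_iff, sub_eq_zero] at this
    exact this
  rcases zero_notMem_segment_or hy he with h1 | h1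
  · exact key y h1
  · rw [← hev, key _ h1]

lemma contDiffOn_pd {f : E n → ℝ} (hf : ContDiffOn ℝ ∞ f {0}ᶜ) (i : Fin n) :
    ContDiffOn ℝ ∞ (pd i f) {0}ᶜ :=
  (hf.fderiv_of_isOpen isOpen_compl_singleton (by simp)).clm_apply contDiffOn_const

lemma differentiableAt_of_ne_zero {f : E n → ℝ} (hf : ContDiffOn ℝ ∞ f {0}ᶜ) (hy : y ≠ 0) :
    DifferentiableAt ℝ f y :=
  (hf.contDiffAt (isOpen_compl_singleton.mem_nhds hy)).differentiableAt (by simp)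

/-- The connection coefficients `∂²Gⁱ/∂yᵏ∂yˡ (x, e)`. For a Berwald metric they do not depend on
the reference vector `e ≠ 0`. -/
noncomputable def christoffel (F : E n → E n → ℝ) (e x : E n) (i k l : Fin n) : ℝ :=
  pd k (pd l fun z => spray F x z i) e

/-- The connection coefficients at the reference vector `e`, as a bilinear map
`(w, y) ↦ (∂²Gⁱ/∂yᵏ∂yˡ (x, e)) wˡ yᵏ`. -/
noncomputable def connection (F : E n → E n → ℝ) (e x : E n) : E n →L[ℝ] E n →L[ℝ] E n :=
  ∑ i, ∑ k, ∑ l, christoffel F e x i k l •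
    (EuclideanSpace.proj l : E n →L[ℝ] ℝ).smulRight
      ((EuclideanSpace.proj k : E n →L[ℝ] ℝ).smulRight (EuclideanSpace.single i (1 : ℝ)))

lemma connection_apply (F : E n → E n → ℝ) (e x w y : E n) (i : Fin n) :
    connection F e x w y i = ∑ k, ∑ l, christoffel F e x i k l * (w l * y k) := by
  simp only [connection, sum_apply, smul_apply,
    ContinuousLinearMap.smulRight_apply]
  simp [Pi.single_apply, Finset.sum_apply]

lemma contDiffOn_spray (hU : IsOpen U) (hF : IsFinslerMetric U F) (i : Fin n) :
    ContDiffOn ℝ ∞ (fun p : E n × E n => spray F p.1 p.2 i) (slitBundle U) :=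
  contDiffOn_euclidean.1 (contDiffOn_sprayVec hU hF) i

lemma contDiffOn_smul_const {V : Type*} [NormedAddCommGroup V] [NormedSpace ℝ V]
    {f : E n → ℝ} {s : Set (E n)} (hf : ContDiffOn ℝ ∞ f s) (v : V) :
    ContDiffOn ℝ ∞ (fun z => f z • v) s :=
  hf.smul contDiffOn_const

lemma contDiffOn_connection (hU : IsOpen U) (hF : IsFinslerMetric U F) (he : e ≠ 0) :
    ContDiffOn ℝ ∞ (connection F e) U := by
  refine ContDiffOn.sum fun i _ => ContDiffOn.sum fun k _ => ContDiffOn.sum fun l _ =>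
    contDiffOn_smul_const ?_ _
  have hG := contDiffOn_spray hU hF i
  have h1 := (contDiffOn_fderiv_apply hU (contDiffOn_fderiv hU hG)
    (0, EuclideanSpace.single k 1)).clm_apply
    (contDiffOn_const (c := ((0 : E n), (EuclideanSpace.single l 1 : E n))))
  exact (h1.comp (contDiff_id.prodMk contDiff_const).contDiffOn
    (fun z hz => ⟨hz, he⟩)).congr fun z hz => pd_pd_slice hU hG ⟨hz, he⟩ k l

section Berwald

variable (hU : IsOpen U) (hF : IsFinslerMetric U F) (hev : ∀ x ∈ U, ∀ y, F x (-y) = F x y)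
  (hB : ∀ x ∈ U, ∀ y, y ≠ 0 → ∀ i j k l, berwald F x y i j k l = 0)
include hU hF

lemma contDiffOn_spray_slice (hx : x ∈ U) (i : Fin n) :
    ContDiffOn ℝ ∞ (fun z => spray F x z i) {0}ᶜ :=
  ContDiffOn.comp (g := fun p : E n × E n => spray F p.1 p.2 i) (f := fun z : E n => (x, z))
    (contDiffOn_spray hU hF i) (contDiff_const.prodMk contDiff_id).contDiffOn
    fun _ hz => ⟨hx, hz⟩

include hev

lemma spray_smul_of_even (hx : x ∈ U) {r : ℝ} (hr : r ≠ 0) (y : E n) (i : Fin n) :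
    spray F x (r • y) i = r ^ 2 * spray F x y i :=
  spray_smul hU (fun _ hx _ hr y => sq_smul_of_even hF hev hx hr y) hx hr y i

include hB

lemma christoffel_eq (hx : x ∈ U) (hy : y ≠ 0) (he : e ≠ 0) (i k l : Fin n) :
    christoffel F y x i k l = christoffel F e x i k l := by
  have hs := contDiffOn_pd (contDiffOn_pd (contDiffOn_spray_slice hU hF hx i) l) k
  have h1 : (-1 : ℝ) ≠ 0 := by norm_num
  refine eq_of_even_of_fderiv_eq_zero (h := pd k (pd l fun z => spray F x z i))
    (fun z hz => differentiableAt_of_ne_zero hs hz)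
    (fun z hz => ?_) (fun z => ?_) hy he
  · ext w
    exact clm_eq_zero (fun j => hB x hx z hz i j k l) w
  · have := pd_smul_of_scaling h1 (pd_smul_of_scaling (f := fun z => spray F x z i) h1
      (fun z => spray_smul_of_even hU hF hev hx h1 z i) l) k z
    simpa using this

lemma fderiv_sprayVec (hx : x ∈ U) (hy : y ≠ 0) (he : e ≠ 0) (w : E n) :
    fderiv ℝ (sprayVec F) (x, y) (0, w) = connection F e x w y := by
  ext i
  have hd := differentiableAt_of_slit hU (contDiffOn_sprayVec hU hF) (p := (x, y)) ⟨hx, hy⟩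
  have h1 : (fderiv ℝ (sprayVec F) (x, y) (0, w)) i
      = fderiv ℝ (fun z => spray F x z i) y w := by
    rw [fderiv_slice_snd (f := fun p => spray F p.1 p.2 i)
      (differentiableAt_of_slit hU (contDiffOn_spray hU hF i) ⟨hx, hy⟩)]
    have h := (EuclideanSpace.proj i : E n →L[ℝ] ℝ).hasFDerivAt.comp (x, y) hd.hasFDerivAt
    have h' : fderiv ℝ (fun p : E n × E n => spray F p.1 p.2 i) (x, y) = _ := h.fderiv
    rw [h']
    rfl
  have hs := contDiffOn_spray_slice hU hF hx i
  have h2 : ∀ l, pd l (fun z => spray F x z i) y = ∑ k, y k * christoffel F e x i k l := by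
    intro l
    have hE := fderiv_self_of_homogeneous
      (differentiableAt_of_ne_zero (contDiffOn_pd hs l) hy) 1 fun r hr => by
        rw [pd_smul_of_scaling hr.ne' (fun z => spray_smul_of_even hU hF hev hx hr.ne' z i)]
        rw [smul_eq_mul]
        field_simp
    rw [clm_eq_sum] at hE
    simp only [Nat.cast_one, one_mul, smul_eq_mul] at hE
    rw [← hE]
    refine Finset.sum_congr rfl fun k _ => ?_
    rw [← christoffel_eq hU hF hev hB hx hy he]
    rfl
  rw [h1, clm_eq_sum, connection_apply, Finset.sum_comm]
  refine Finset.sum_congr rfl fun l _ => ?_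
  change w l * pd l (fun z => spray F x z i) y = _
  rw [h2, Finset.mul_sum]
  exact Finset.sum_congr rfl fun k _ => by ring

lemma connection_self (hx : x ∈ U) (hy : y ≠ 0) (he : e ≠ 0) :
    connection F e x y y = (2 : ℝ) • sprayVec F (x, y) := by
  have hd := differentiableAt_of_slit hU (contDiffOn_sprayVec hU hF) (p := (x, y)) ⟨hx, hy⟩
  rw [← fderiv_sprayVec hU hF hev hB hx hy he, ← fderiv_slice_snd hd,
    fderiv_self_of_homogeneous (f := fun z => sprayVec F (x, z))
      (hd.comp y (hasFDerivAt_prodMk_right x y).differentiableAt) 2]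
  · simp
  · intro r hr
    ext i
    exact spray_smul_of_even hU hF hev hx hr.ne' y i

end Berwald

/-! ### Parallel transport along geodesics -/

/-- Parallel transport `P` along the curve `σ` it generates by `σ̇ = P y`, as an autonomous vector
field on the pairs `(σ, P)`. -/
noncomputable def transportField (F : E n → E n → ℝ) (y : E n) (q : E n × (E n →L[ℝ] E n)) :
    E n × (E n →L[ℝ] E n) :=
  (q.2 y, -(connection F y q.1 (q.2 y)).comp q.2)

lemma contDiffAt_transportField (hU : IsOpen U) (hF : IsFinslerMetric U F) (hx : x ∈ U)
    (hy : y ≠ 0) (P : E n →L[ℝ] E n) : ContDiffAt ℝ 1 (transportField F y) (x, P) := by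
  have hC : ContDiffAt ℝ 1 (connection F y) x :=
    ((contDiffOn_connection hU hF hy).contDiffAt (hU.mem_nhds hx)).of_le (by simp)
  have hC' : ContDiffAt ℝ 1 (fun q : E n × (E n →L[ℝ] E n) => connection F y q.1) (x, P) :=
    ContDiffAt.comp (g := connection F y) (x, P) hC contDiffAt_fst
  have hv : ContDiffAt ℝ 1 (fun q : E n × (E n →L[ℝ] E n) => q.2 y) (x, P) :=
    contDiffAt_snd.clm_apply contDiffAt_const
  exact hv.prodMk ((hC'.clm_apply hv).clm_comp contDiffAt_snd).neg

lemma bijective_of_det_ne_zero {A : E n →L[ℝ] E n} (hA : A.det ≠ 0) : Function.Bijective A :=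
  (LinearMap.equivOfDetNeZero (A : E n →ₗ[ℝ] E n) hA).bijective

/-- Every tangent vector generates a curve together with a parallel transport along it that maps
the initial velocity to the velocity. -/
lemma exists_transport (hU : IsOpen U) (hF : IsFinslerMetric U F) (hx : x ∈ U) (hy : y ≠ 0) :
    ∃ ε > 0, ∃ (σ : ℝ → E n) (P : ℝ → E n →L[ℝ] E n), σ 0 = x ∧ P 0 = .id ℝ (E n) ∧
      ∀ t ∈ Set.Ioo (-ε) ε, σ t ∈ U ∧ (P t).det ≠ 0 ∧ HasDerivAt σ (P t y) t ∧
        HasDerivAt P (-(connection F y (σ t) (P t y)).comp (P t)) t := by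
  obtain ⟨α, h0, ε, hε, hα⟩ :=
    (contDiffAt_transportField hU hF hx hy
      (.id ℝ (E n))).exists_forall_mem_closedBall_exists_eq_forall_mem_Ioo_hasDerivAt₀ 0
  have hc : ContinuousAt α 0 := (hα 0 (by constructor <;> linarith)).continuousAt
  have h1 : ∀ᶠ t in 𝓝 (0 : ℝ), (α t).1 ∈ U :=
    hc.fst.eventually_mem (hU.mem_nhds (by rw [h0]; exact hx))
  have h2 : ∀ᶠ t in 𝓝 (0 : ℝ), (α t).2.det ≠ 0 := by
    refine (ContinuousLinearMap.continuous_det.continuousAt.comp hc.snd).eventually_ne ?_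
    simp [h0, ContinuousLinearMap.det]
  have h3 : ∀ᶠ t in 𝓝 (0 : ℝ), HasDerivAt α (transportField F y (α t)) t := by
    filter_upwards [Ioo_mem_nhds (show 0 - ε < 0 by linarith) (show 0 < 0 + ε by linarith)]
      with t ht using hα t ht
  obtain ⟨δ, hδ, h⟩ := Metric.eventually_nhds_iff_ball.1 (h1.and (h2.and h3))
  refine ⟨δ, hδ, fun t => (α t).1, fun t => (α t).2, by simp [h0], by simp [h0], ?_⟩
  intro t ht
  obtain ⟨a, b, c⟩ := h t (by rw [Real.ball_eq_Ioo]; simpa using ht)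
  exact ⟨a, b, c.fst, c.snd⟩

lemma contDiffAt_sprayVec (hU : IsOpen U) (hF : IsFinslerMetric U F) (hx : x ∈ U) (hy : y ≠ 0) :
    ContDiffAt ℝ 1 (sprayVec F) (x, y) :=
  ((contDiffOn_sprayVec hU hF).contDiffAt
    ((isOpen_slitBundle hU).mem_nhds ⟨hx, hy⟩)).of_le (by simp)

lemma IsGeodesicFrom.hasDerivAt_velocity {ε : ℝ} {σ : ℝ → E n} (h : IsGeodesicFrom U F x y ε σ)
    {t : ℝ} (ht : t ∈ Set.Ioo (-ε) ε) : HasDerivAt (fun t => (σ t, deriv σ t))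
      (deriv σ t, (-2 : ℝ) • sprayVec F (σ t, deriv σ t)) t :=
  (h.differentiable t ht).hasDerivAt.prodMk (h.geodesic_eq t ht)

/-- Two geodesics with the same initial velocity agree near `0`. -/
lemma IsGeodesicFrom.eventuallyEq (hU : IsOpen U) (hF : IsFinslerMetric U F)
    (hx : x ∈ U) (hy : y ≠ 0) {ε₁ ε₂ : ℝ} {σ₁ σ₂ : ℝ → E n}
    (h₁ : IsGeodesicFrom U F x y ε₁ σ₁) (h₂ : IsGeodesicFrom U F x y ε₂ σ₂) :
    (fun t => (σ₁ t, deriv σ₁ t)) =ᶠ[𝓝 0] fun t => (σ₂ t, deriv σ₂ t) := by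
  have hY : ContDiffAt ℝ 1 (fun p : E n × E n => (p.2, (-2 : ℝ) • sprayVec F p)) (x, y) :=
    contDiffAt_snd.prodMk ((contDiffAt_sprayVec hU hF hx hy).const_smul _)
  obtain ⟨K, s, hs, hlip⟩ := hY.exists_lipschitzOnWith
  have key : ∀ {ε : ℝ} {σ : ℝ → E n}, IsGeodesicFrom U F x y ε σ →
      ∀ᶠ t in 𝓝 (0 : ℝ), HasDerivAt (fun t => (σ t, deriv σ t))
        (deriv σ t, (-2 : ℝ) • sprayVec F (σ t, deriv σ t)) t ∧ (σ t, deriv σ t) ∈ s := by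
    intro ε σ h
    have hc := (h.hasDerivAt_velocity ⟨neg_lt_zero.2 h.pos, h.pos⟩).continuousAt
    refine Eventually.and ?_ (hc.eventually_mem (by rw [h.start, h.velocity]; exact hs))
    filter_upwards [Ioo_mem_nhds (neg_lt_zero.2 h.pos) h.pos] with t ht
      using h.hasDerivAt_velocity ht
  exact ODE_solution_unique_of_eventually (K := K) (s := fun _ => s)
    (v := fun _ p => (p.2, (-2 : ℝ) • sprayVec F p)) (Eventually.of_forall fun _ => hlip)
    (key h₁) (key h₂) (by simp [h₁.start, h₁.velocity, h₂.start, h₂.velocity])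

section Berwald

variable (hU : IsOpen U) (hF : IsFinslerMetric U F) (hev : ∀ x ∈ U, ∀ y, F x (-y) = F x y)
  (hB : ∀ x ∈ U, ∀ y, y ≠ 0 → ∀ i j k l, berwald F x y i j k l = 0)
include hU hF hev hB

/-- Parallel transport preserves `F`: its infinitesimal generator is horizontal. -/
lemma energy_transport {ε : ℝ} {σ : ℝ → E n} {P : ℝ → E n →L[ℝ] E n} (hy : y ≠ 0)
    (h0 : σ 0 = x) (hP0 : P 0 = .id ℝ (E n))
    (h : ∀ t ∈ Set.Ioo (-ε) ε, σ t ∈ U ∧ (P t).det ≠ 0 ∧ HasDerivAt σ (P t y) t ∧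
      HasDerivAt P (-(connection F y (σ t) (P t y)).comp (P t)) t)
    {z : E n} (hz : z ≠ 0) {t : ℝ} (ht : t ∈ Set.Ioo (-ε) ε) :
    energy F (σ t, P t z) = energy F (x, z) := by
  have hd : ∀ t ∈ Set.Ioo (-ε) ε, HasDerivAt (fun t => energy F (σ t, P t z)) 0 t := by
    intro t ht
    obtain ⟨hσ, hdet, h1, h2⟩ := h t ht
    have hPz : P t z ≠ 0 := by
      rw [← map_zero (P t)]
      exact (bijective_of_det_ne_zero hdet).1.ne hz
    have hp : (σ t, P t z) ∈ slitBundle U := ⟨hσ, hPz⟩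
    have h3 : HasDerivAt (fun t => P t z) (-(connection F y (σ t) (P t y) (P t z))) t := by
      simpa using h2.clm_apply (hasDerivAt_const t z)
    have h4 := (differentiableAt_of_slit hU hF.contDiffOn_energy hp).hasFDerivAt.comp_hasDerivAt
      t (h1.prodMk h3)
    have h5 := fderiv_energy_horizontal hU hF hp (P t y)
    rw [fderiv_sprayVec hU hF hev hB hσ hPz hy] at h5
    have h6 : fderiv ℝ (energy F) (σ t, P t z)
        (P t y, -(connection F y (σ t) (P t y) (P t z))) = 0 := by
      rw [show ((P t y, -(connection F y (σ t) (P t y) (P t z))) : E n × E n)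
        = (P t y, 0) - (0, connection F y (σ t) (P t y) (P t z)) by simp, map_sub, h5, sub_self]
    rwa [h6] at h4
  have hε : (0 : ℝ) ∈ Set.Ioo (-ε) ε := by
    have := ht.1.trans ht.2
    constructor <;> linarith
  have := isOpen_Ioo.is_const_of_deriv_eq_zero isPreconnected_Ioo
    (fun t ht => (hd t ht).differentiableAt.differentiableWithinAt)
    (fun t ht => (hd t ht).deriv) ht hε
  rw [this, h0, hP0]
  rfl

/-- The curve generated by parallel transport is a geodesic. -/
lemma isGeodesicFrom_of_transport {ε : ℝ} (hε : 0 < ε) {σ : ℝ → E n} {P : ℝ → E n →L[ℝ] E n}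
    (hy : y ≠ 0) (h0 : σ 0 = x) (hP0 : P 0 = .id ℝ (E n))
    (h : ∀ t ∈ Set.Ioo (-ε) ε, σ t ∈ U ∧ (P t).det ≠ 0 ∧ HasDerivAt σ (P t y) t ∧
      HasDerivAt P (-(connection F y (σ t) (P t y)).comp (P t)) t) :
    IsGeodesicFrom U F x y ε σ := by
  have hv : ∀ t ∈ Set.Ioo (-ε) ε, deriv σ t = P t y := fun t ht => (h t ht).2.2.1.deriv
  have hne : ∀ t ∈ Set.Ioo (-ε) ε, P t y ≠ 0 := fun t ht => by
    rw [← map_zero (P t)]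
    exact (bijective_of_det_ne_zero (h t ht).2.1).1.ne hy
  refine ⟨hε, h0, ?_, fun t ht => (h t ht).1, fun t ht => hv t ht ▸ hne t ht,
    fun t ht => (h t ht).2.2.1.differentiableAt, fun t ht => ?_⟩
  · rw [hv 0 ⟨neg_lt_zero.2 hε, hε⟩, hP0]
    rfl
  · have h1 : HasDerivAt (fun t => P t y) (-(connection F y (σ t) (P t y) (P t y))) t := by
      simpa using (h t ht).2.2.2.clm_apply (hasDerivAt_const t y)
    rw [connection_self hU hF hev hB (h t ht).1 (hne t ht) hy] at h1
    have h2 := h1.congr_of_eventuallyEq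
      (by filter_upwards [Ioo_mem_nhds ht.1 ht.2] with s hs using hv s hs)
    have h3 : (WithLp.toLp 2 fun i => -2 * spray F (σ t) (deriv σ t) i : E n)
        = -((2 : ℝ) • sprayVec F (σ t, P t y)) := by
      rw [hv t ht]
      ext i
      simp [sprayVec]
    rwa [h3]

end Berwald

/-! ### Invariance of the distortion under linear isometries -/

lemma pd_comp_clm {f : E n → ℝ} {A : E n →L[ℝ] E n} {z : E n}
    (hf : DifferentiableAt ℝ f (A z)) (j : Fin n) :
    pd j (fun z => f (A z)) z = ∑ k, A (EuclideanSpace.single j 1) k * pd k f (A z) := by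
  have h : fderiv ℝ (fun z => f (A z)) z = _ := (hf.hasFDerivAt.comp z A.hasFDerivAt).fderiv
  rw [pd, h, ContinuousLinearMap.comp_apply, clm_eq_sum]
  rfl

lemma fundTensor_comp_clm (hF : IsFinslerMetric U F) (hx' : x' ∈ U)
    {A : E n →L[ℝ] E n} (hA : Function.Injective A) (h : ∀ z ≠ 0, F x' (A z) ^ 2 = F x z ^ 2)
    (hy : y ≠ 0) {M : Matrix (Fin n) (Fin n) ℝ}
    (hM : ∀ i j, M i j = A (EuclideanSpace.single j 1) i) :
    fundTensor F x y = M.transpose * fundTensor F x' (A y) * M := by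
  have hne : ∀ z ≠ 0, A z ≠ 0 := fun z hz => by
    rw [← map_zero A]
    exact hA.ne hz
  have hf : ContDiffOn ℝ ∞ (fun z => F x' z ^ 2) {0}ᶜ :=
    ContDiffOn.comp (g := energy F) (f := fun z : E n => (x', z)) hF.contDiffOn_energy
      (contDiff_const.prodMk contDiff_id).contDiffOn fun _ hz => ⟨hx', hz⟩
  have h1 : ∀ z ≠ 0, ∀ j, pd j (fun z => F x z ^ 2) z
      = ∑ k, M k j * pd k (fun z => F x' z ^ 2) (A z) := by
    intro z hz j
    simp only [hM]
    rw [← pd_comp_clm (differentiableAt_of_ne_zero hf (hne z hz))]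
    refine pd_congr ?_ j
    filter_upwards [isOpen_ne.mem_nhds hz] with u hu using (h u hu).symm
  ext i j
  have h2 : pd i (pd j fun z => F x z ^ 2) y
      = pd i (fun z => ∑ k, M k j * pd k (fun z => F x' z ^ 2) (A z)) y :=
    pd_congr (by filter_upwards [isOpen_ne.mem_nhds hy] with z hz using h1 z hz j) i
  have hd := fun k => differentiableAt_of_ne_zero (contDiffOn_pd hf k) (hne y hy)
  have h3 : pd i (fun z => ∑ k, M k j * pd k (fun z => F x' z ^ 2) (A z)) y
      = ∑ k, M k j * pd i (fun z => pd k (fun z => F x' z ^ 2) (A z)) y := by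
    have hd' : ∀ k, DifferentiableAt ℝ
        (fun z => M k j * pd k (fun z => F x' z ^ 2) (A z)) y := fun k =>
      ((hd k).comp y A.differentiableAt).const_mul (M k j)
    rw [pd, fderiv_fun_sum fun k _ => hd' k, sum_apply]
    exact Finset.sum_congr rfl fun k _ => pd_const_mul i _ _ _
  rw [Matrix.mul_apply]
  simp only [fundTensor, Matrix.mul_apply, Matrix.of_apply, Matrix.transpose_apply]
  rw [h2, h3, Finset.mul_sum]
  refine Finset.sum_congr rfl fun k _ => ?_
  rw [pd_comp_clm (hd k)]
  simp only [← hM, Finset.mul_sum, Finset.sum_mul]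
  exact Finset.sum_congr rfl fun l _ => by ring

/-- A linear isometry `A` between two tangent spaces multiplies the volume of the unit ball by
`|det A|` and divides `√(det g)` by the same factor. -/
lemma distortion_comp_clm (hF : IsFinslerMetric U F) (hx : x ∈ U) (hx' : x' ∈ U)
    {A : E n →L[ℝ] E n} (hA : A.det ≠ 0) (h : ∀ z ≠ 0, F x' (A z) ^ 2 = F x z ^ 2)
    (hy : y ≠ 0) : distortion F x' (A y) = distortion F x y := by
  have hbij := bijective_of_det_ne_zero hA
  have hzero : ∀ u ∈ U, F u 0 = 0 := fun u hu => by
    have := hF.homogeneous u hu 0 2 two_pos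
    rw [smul_zero] at this
    linarith
  have hiso : ∀ z, F x' (A z) = F x z := by
    intro z
    by_cases hz : z = 0
    · rw [hz, map_zero, hzero x hx, hzero x' hx']
    · exact (pow_left_inj₀ (hF.nonneg _ hx' _) (hF.nonneg _ hx _) two_ne_zero).1 (h z hz)
  have hvol : MeasureTheory.volume.real {z : E n | F x' z < 1}
      = |A.det| * MeasureTheory.volume.real {z : E n | F x z < 1} := by
    have himg : {z : E n | F x' z < 1} = A '' {z : E n | F x z < 1} := by
      ext u
      obtain ⟨z, rfl⟩ := hbij.2 u
      rw [hbij.1.mem_set_image]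
      simp [hiso]
    rw [himg, MeasureTheory.measureReal_def,
      MeasureTheory.Measure.addHaar_image_continuousLinearMap, ENNReal.toReal_mul,
      ENNReal.toReal_ofReal (abs_nonneg _), MeasureTheory.measureReal_def]
  set b := (EuclideanSpace.basisFun (Fin n) ℝ).toBasis
  have hg := fundTensor_comp_clm hF hx' hbij.1 h hy
    (M := LinearMap.toMatrix b b (A : E n →ₗ[ℝ] E n)) fun i j => by
      simp [b, LinearMap.toMatrix_apply]
  have hdet : (fundTensor F x y).det = A.det ^ 2 * (fundTensor F x' (A y)).det := by
    rw [hg, Matrix.det_mul, Matrix.det_mul, Matrix.det_transpose, LinearMap.det_toMatrix,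
      ContinuousLinearMap.det]
    ring
  rw [distortion, distortion, hvol, hdet, Real.sqrt_mul (sq_nonneg _), Real.sqrt_sq_eq_abs]
  congr 1
  ring

end FinslerRoot

theorem corollary3p5 {n m : ℕ} (hm : 1 ≤ m)
    (U : Set (FinslerRoot.E n)) (hU : IsOpen U)
    (F : FinslerRoot.E n → FinslerRoot.E n → ℝ)
    (hF : FinslerRoot.IsFinslerMetric U F)
    (hroot : FinslerRoot.IsRootMetric m U F)
    (hB : FinslerRoot.HasIsotropicBerwaldCurvature U F) :
    ∀ x ∈ U, ∀ y, y ≠ 0 → FinslerRoot.HasSCurvatureAt U F x y 0 := by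
  intro x hx y hy
  have hev : ∀ x ∈ U, ∀ y, F x (-y) = F x y := fun x hx y => hroot.map_neg hm hF.nonneg hx y
  have hB0 : ∀ x ∈ U, ∀ y, y ≠ 0 → ∀ i j k l, FinslerRoot.berwald F x y i j k l = 0 :=
    fun x hx y hy => hB.berwald_eq_zero hU hF hev hx hy
  obtain ⟨ε, hε, σ, P, h0, hP0, h⟩ := FinslerRoot.exists_transport hU hF hx hy
  have hgeo := FinslerRoot.isGeodesicFrom_of_transport hU hF hev hB0 hε hy h0 hP0 h
  refine ⟨⟨ε, σ, hgeo⟩, fun ε' σ' h' => ?_⟩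
  refine (hasDerivAt_const (0 : ℝ) (FinslerRoot.distortion F x y)).congr_of_eventuallyEq ?_
  filter_upwards [h'.eventuallyEq hU hF hx hy hgeo, Ioo_mem_nhds (neg_lt_zero.2 hε) hε]
    with t ht htε
  obtain ⟨h1, h2⟩ := Prod.ext_iff.1 ht
  dsimp only at h1 h2
  rw [h1, h2, (h t htε).2.2.1.deriv]
  exact FinslerRoot.distortion_comp_clm hF hx (h t htε).1 (h t htε).2.1
    (fun z hz => FinslerRoot.energy_transport hU hF hev hB0 hy h0 hP0 h hz htε) hy
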